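/- Let $\mathbb{Z}^+=\{1,2,\dots\}$. A partially computable function $U\colon\mathbb{Z}^+\to\mathbb{Z}^+\cup\{\infty\}$ (the value $\infty$ meaning "undefined") is called universal if there is a (total) computable function $C_U\colon\mathbb{Z}^+\times\mathbb{Z}^+\to\mathbb{Z}^+$ such that for every partially computable function $F\colon\mathbb{Z}^+\to\mathbb{Z}^+\cup\{\infty\}$ there is $g\in\mathbb{Z}^+$ with $U(C_U(g,x))=F(x)$ for all $x\in\mathbb{Z}^+$. Its halting set is $\mathrm{Halt}(U)=\{x\in\mathbb{Z}^+ : U(x)\neq\infty\}$. A set $A\subseteq\mathbb{Z}^+$ has density $d(A)$ if the limit $d(A)=\lim_{N\to\infty}\frac{1}{N}\#(\{1,\dots,N\}\cap A)$ exists, and $A$ is generic if $d(A)=1$. For $r\in(0,1]$, a set $S\subseteq\mathbb{Z}^+$ is $r$-decidable if there is a decidable set $R\subseteq\mathbb{Z}^+$ such that $d(R)=r$ and $R\cap S$ is decidable; $S$ is weakly decidable if it is $r$-decidable for some $r\in(0,1)$. Theorem. There exist infinitely many universal functions $U$ whose halting sets $\mathrm{Halt}(U)$ are generic and not weakly decidable,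 that is, generic and not $r$-decidable for any $r\in(0,1)$. -/

import Mathlib

open Filter Topology

namespace HaltingDensity

/-- `U : ℤ⁺ → ℤ⁺ ∪ {∞}` (a partial function on the positive integers) is (Turing) universal: it is
partially computable, and there is one total computable `C` such that every partially computable
`F` has a Gödel number `g` with `U (C (g, x)) = F x` for all `x`; the equality is one of partial
values (both sides undefined, or both defined and equal). -/
def IsUniversal (U : ℕ+ →. ℕ+) : Prop :=
  Partrec U ∧ ∃ C : ℕ+ → ℕ+ → ℕ+, Computable₂ C ∧
    ∀ F : ℕ+ →. ℕ+, Partrec F → ∃ g : ℕ+, ∀ x : ℕ+, U (C g x) = F x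

/-- The halting set of a partial function: its domain. -/
def haltingSet (U : ℕ+ →. ℕ+) : Set ℕ+ := {x | (U x).Dom}

/-- A set of positive integers is decidable if membership in it is computable. -/
def IsDecidable (S : Set ℕ+) : Prop := ComputablePred fun x => x ∈ S

/-- `A` has natural density `d`: the limit of `#({1, …, N} ∩ A) / N` exists and equals `d`. -/
def HasDensity (A : Set ℕ+) (d : ℝ) : Prop :=
  Tendsto (fun N : ℕ+ => ((Set.Icc 1 N ∩ A).ncard : ℝ) / (N : ℝ)) atTop (𝓝 d)

/-- A set is generic if it has density one. -/
def IsGeneric (A : Set ℕ+) : Prop := HasDensity A 1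

/-- `S` is `r`-decidable if its intersection with some decidable set of density `r` is
decidable. -/
def IsRDecidable (r : ℝ) (S : Set ℕ+) : Prop :=
  ∃ R : Set ℕ+, IsDecidable R ∧ HasDensity R r ∧ IsDecidable (R ∩ S)

/-- `S` is weakly decidable if it is `r`-decidable for some `r` strictly between `0` and `1`. -/
def IsWeaklyDecidable (S : Set ℕ+) : Prop :=
  ∃ r : ℝ, 0 < r ∧ r < 1 ∧ IsRDecidable r S

end HaltingDensity

/-!
Write a positive integer as `x = 2 ^ n + y` with `y < 2 ^ n`. On the powers of two (`y = 0`), which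
have density zero, `universalFun k` simulates a universal machine on the exponent. Off the powers of
two it can only halt with the value `k`, and the points where it does so are enumerated in such a
way that the halting set is generic while no decidable subset of it has positive density
(`HasDensity.nonpos_of_subset_haltingSet`). This rules out weak decidability: if `R` is decidable of
density `r` and `R ∩ Halt` is decidable, then `R ∩ Halt` also has density `r`
(`HasDensity.inter_isGeneric`).

The block `[2 ^ n, 2 ^ (n + 1))` without its first point is partitioned into gaps, the `e`-th of
which has a length roughly proportional to `2 ^ n`. It is used against the decidable set `D` with
index `e`, that is, the set whose decision procedure is the `e`-th code. For each `e`, one gap at a time is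
withheld from the enumeration, namely the one in the block `activeBlock e n` at stage `n`; all other
`e`-th gaps are enumerated at once. A withheld gap is released, and a new one chosen in a later
block, when the `e`-th code has been seen to reject all of its points.

* At most one gap per index is withheld forever (`exists_bound_of_not_enumerated`), and the gaps of
  large index lie within a small initial fraction of their blocks
  (`card_filter_mul_offset_le`), so the halting set is generic (`isGeneric_haltingSet`).
* If a decidable set `D` is contained in the halting set, then a gap withheld forever would be
  disjoint from `D`, and would thus be released if `e` is the index of `D`; so every gap withheld
  for this `e` is eventually released (`exists_clearedBy`). Hence infinitely many gaps are withheld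
  at first, and all of them are disjoint from `D` (`exists_gap_disjoint`). A set missing
  infinitely many intervals of fixed relative length has no positive density
  (`HasDensity.nonpos_of_gaps`).
-/

open Nat.Partrec (Code)

namespace HaltingDensity

/-! ### Blocks and gaps -/

/-- The distance from `x` to the largest power of two not exceeding it. -/
def offset (x : ℕ) : ℕ := x - 2 ^ Nat.log 2 x

/-- The index of the gap containing `x`: for `n = Nat.log 2 x` and `0 < e`, the `e`-th gap of the
block `[2 ^ n, 2 ^ (n + 1))` consists of those `x = 2 ^ n + y` with `2 ^ n / y = e + 2`, and so
takes up a proportion about `1 / ((e + 2) * (e + 3))` of the block. By truncated subtraction the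
gap of index `0` extends to the end of the block. The beginning `2 ^ n` of the block is assigned the
index `0` too (`2 ^ n / 0 = 0`), but is not regarded as belonging to a gap. -/
def gapIndex (x : ℕ) : ℕ := 2 ^ Nat.log 2 x / offset x - 2

/-- Within `s` steps, the `e`-th code outputs `0` (the code of `false`) on the whole `e`-th gap of
the `n`-th block. The bound on `x` is redundant, but makes the quantifier visibly finite. -/
def ClearedBy (n e s : ℕ) : Prop :=
  ∀ x < 2 ^ (n + 1), Nat.log 2 x = n ∧ offset x ≠ 0 ∧ gapIndex x = e →
    Code.evaln s (Denumerable.ofNat Code e) x = some 0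

instance (n e s : ℕ) : Decidable (ClearedBy n e s) := by
  unfold ClearedBy; infer_instance

/-- The block whose `e`-th gap is withheld at stage `n`: it moves on to the newest block as soon as
the current gap has been cleared. -/
def activeBlock (e : ℕ) : ℕ → ℕ
  | 0 => 0
  | n + 1 => if ClearedBy (activeBlock e n) e n then n + 1 else activeBlock e n

/-- The point `x`, if not a power of two, is enumerated by stage `s`: its gap was never withheld,
or has been cleared. -/
def EnumeratedBy (x s : ℕ) : Prop :=
  activeBlock (gapIndex x) (Nat.log 2 x) ≠ Nat.log 2 x ∨ ClearedBy (Nat.log 2 x) (gapIndex x) s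

instance (x s : ℕ) : Decidable (EnumeratedBy x s) := by
  unfold EnumeratedBy; infer_instance

theorem log_two_pow_add {n y : ℕ} (hy : y < 2 ^ n) : Nat.log 2 (2 ^ n + y) = n :=
  (Nat.log_eq_iff (Or.inr ⟨one_lt_two, by positivity⟩)).2 ⟨by omega, by rw [pow_succ]; omega⟩

theorem offset_two_pow_add {n y : ℕ} (hy : y < 2 ^ n) : offset (2 ^ n + y) = y := by
  rw [offset, log_two_pow_add hy]; omega

theorem gapIndex_two_pow_add {n y : ℕ} (hy : y < 2 ^ n) :
    gapIndex (2 ^ n + y) = 2 ^ n / y - 2 := by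
  rw [gapIndex, log_two_pow_add hy, offset_two_pow_add hy]

theorem lt_two_pow_log_succ (x : ℕ) : x < 2 ^ (Nat.log 2 x + 1) :=
  Nat.lt_pow_succ_log_self one_lt_two x

theorem ClearedBy.mono {n e s t : ℕ} (h : ClearedBy n e s) (hst : s ≤ t) : ClearedBy n e t :=
  fun x hx hxe => Code.evaln_mono hst (h x hx hxe)

/-- The active block was active when it was the newest one. -/
theorem activeBlock_activeBlock (e n : ℕ) :
    activeBlock e (activeBlock e n) = activeBlock e n := by
  induction n with
  | zero => rfl
  | succ n ih =>
    by_cases h : ClearedBy (activeBlock e n) e n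
    · have : activeBlock e (n + 1) = n + 1 := by rw [activeBlock, if_pos h]
      rw [this, this]
    · have : activeBlock e (n + 1) = activeBlock e n := by rw [activeBlock, if_neg h]
      rw [this, ih]

/-- A gap that is never cleared blocks the withholding of later gaps with the same index. -/
theorem activeBlock_eq_of_not_cleared {e n : ℕ} (hn : activeBlock e n = n)
    (hc : ∀ s, ¬ ClearedBy n e s) {m : ℕ} (hm : n ≤ m) : activeBlock e m = n := by
  induction m, hm using Nat.le_induction with
  | base => exact hn
  | succ m _ ih => rw [activeBlock, ih, if_neg (hc m)]

/-- If every withheld gap is eventually cleared, then infinitely many gaps are withheld. -/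
theorem exists_activeBlock_eq {e : ℕ}
    (h : ∀ n, activeBlock e n = n → ∃ s, ClearedBy n e s) (N : ℕ) :
    ∃ n, N ≤ n ∧ activeBlock e n = n := by
  by_contra! hN
  have hconst : ∀ m, N ≤ m → activeBlock e m = activeBlock e N := by
    intro m hm
    induction m, hm using Nat.le_induction with
    | base => rfl
    | succ m hm ih =>
      have := hN (m + 1) (by omega)
      rw [activeBlock] at this ⊢
      split_ifs at this ⊢ with hc
      · exact absurd rfl this
      · exact ih
  obtain ⟨s, hs⟩ := h _ (activeBlock_activeBlock e N)
  have hle : N ≤ max N s := le_max_left _ _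
  refine hN (max N s + 1) (by omega) ?_
  rw [activeBlock, hconst _ hle, if_pos (hs.mono (le_max_right _ _))]

/-! ### Computability of the enumeration -/

theorem primrec_two_pow : Primrec fun n : ℕ => 2 ^ n :=
  (Primrec₂.unpaired'.1 Nat.Primrec.pow).comp (Primrec.const 2) Primrec.id

theorem primrec_log_two : Primrec fun n : ℕ => Nat.log 2 n := by
  refine (Primrec.nat_findGreatest (f := fun n : ℕ => n) (p := fun n k => k ≠ 0 ∧ 2 ^ k ≤ n)
    Primrec.id ?_).of_eq fun n => ?_
  · exact ((Primrec.eq.comp Primrec.snd (Primrec.const 0)).not.and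
      (Primrec.nat_le.comp (primrec_two_pow.comp Primrec.snd) Primrec.fst)).primrecRel
  · rw [Nat.findGreatest_eq_iff]
    refine ⟨Nat.log_le_self 2 n, fun h => ⟨h, ?_⟩, fun k hk _ ⟨_, hle⟩ => ?_⟩
    · exact Nat.pow_log_le_self 2 (by rintro rfl; simp at h)
    · exact absurd (Nat.le_log_of_pow_le one_lt_two hle) (by omega)

theorem primrec_offset : Primrec offset :=
  Primrec.nat_sub.comp Primrec.id (primrec_two_pow.comp primrec_log_two)

theorem primrec_gapIndex : Primrec gapIndex :=
  Primrec.nat_sub.comp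
    (Primrec.nat_div.comp (primrec_two_pow.comp primrec_log_two) primrec_offset)
    (Primrec.const 2)

theorem primrecPred_clearedBy :
    PrimrecPred fun p : (ℕ × ℕ) × ℕ => ClearedBy p.1.1 p.1.2 p.2 := by
  have hR : PrimrecRel fun (x : ℕ) (p : (ℕ × ℕ) × ℕ) =>
      ¬ (Nat.log 2 x = p.1.1 ∧ offset x ≠ 0 ∧ gapIndex x = p.1.2) ∨
        Code.evaln p.2 (Denumerable.ofNat Code p.1.2) x = some 0 := by
    have hn : Primrec fun q : ℕ × ((ℕ × ℕ) × ℕ) => q.2.1.1 :=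
      Primrec.fst.comp (Primrec.fst.comp Primrec.snd)
    have he : Primrec fun q : ℕ × ((ℕ × ℕ) × ℕ) => q.2.1.2 :=
      Primrec.snd.comp (Primrec.fst.comp Primrec.snd)
    have hs : Primrec fun q : ℕ × ((ℕ × ℕ) × ℕ) => q.2.2 := Primrec.snd.comp Primrec.snd
    have hev : Primrec fun q : ℕ × ((ℕ × ℕ) × ℕ) =>
        Code.evaln q.2.2 (Denumerable.ofNat Code q.2.1.2) q.1 :=
      Code.primrec_evaln.comp
        ((hs.pair ((Primrec.ofNat Code).comp he)).pair Primrec.fst)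
    exact (((Primrec.eq.comp (primrec_log_two.comp Primrec.fst) hn).and
      ((Primrec.eq.comp (primrec_offset.comp Primrec.fst) (Primrec.const 0)).not.and
        (Primrec.eq.comp (primrec_gapIndex.comp Primrec.fst) he))).not.or
      (Primrec.eq.comp hev (Primrec.const (some 0)))).primrecRel
  have hpow : Primrec fun p : (ℕ × ℕ) × ℕ => 2 ^ (p.1.1 + 1) :=
    primrec_two_pow.comp (Primrec.succ.comp (Primrec.fst.comp Primrec.fst))
  refine (hR.forall_mem_list.comp (Primrec.list_range.comp hpow) Primrec.id).of_eq fun p => ?_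
  simp only [ClearedBy, ← imp_iff_not_or, id, List.mem_range]

theorem primrec_activeBlock : Primrec₂ activeBlock := by
  have hstep : Primrec₂ fun (e : ℕ) (p : ℕ × ℕ) => if ClearedBy p.2 e p.1 then p.1 + 1 else p.2 :=
    Primrec.ite
      (primrecPred_clearedBy.comp
        (f := fun q : ℕ × (ℕ × ℕ) => ((q.2.2, q.1), q.2.1))
        (((Primrec.snd.comp Primrec.snd).pair Primrec.fst).pair (Primrec.fst.comp Primrec.snd)))
      (Primrec.succ.comp (Primrec.fst.comp Primrec.snd)) (Primrec.snd.comp Primrec.snd)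
  refine (Primrec.nat_rec (Primrec.const 0) hstep).of_eq fun e n => ?_
  induction n with
  | zero => rfl
  | succ n ih => rw [activeBlock, ← ih]

theorem primrecRel_enumeratedBy : PrimrecRel EnumeratedBy := by
  have hl : Primrec fun p : ℕ × ℕ => Nat.log 2 p.1 := primrec_log_two.comp Primrec.fst
  have hg : Primrec fun p : ℕ × ℕ => gapIndex p.1 := primrec_gapIndex.comp Primrec.fst
  exact ((Primrec.eq.comp (primrec_activeBlock.comp hg hl) hl).not.or
    (primrecPred_clearedBy.comp ((hl.pair hg).pair Primrec.snd))).primrecRel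

theorem primrec_pnat_val : Primrec fun x : ℕ+ => (x : ℕ) :=
  (Primrec.succ.comp Primrec.encode).of_eq fun x => PNat.natPred_add_one x

/-! ### The universal functions -/

/-- A universal machine on natural numbers: the argument encodes a program and its input. -/
def runPair (m : ℕ) : Part ℕ+ :=
  (Code.eval (Denumerable.ofNat Code m.unpair.1) m.unpair.2).map (Denumerable.ofNat ℕ+)

/-- On powers of two, run the universal machine on the exponent; elsewhere output `k` once the
argument has been enumerated. -/
def universalFun (k : ℕ+) (x : ℕ+) : Part ℕ+ :=
  bif decide (offset x = 0) then runPair (Nat.log 2 x)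
  else (Nat.rfind fun s => Part.some (decide (EnumeratedBy x s))).map fun _ => k

theorem partrec_runPair : Partrec runPair :=
  (Code.eval_part.comp ((Computable.ofNat Code).comp (Computable.fst.comp Computable.unpair))
    (Computable.snd.comp Computable.unpair)).map ((Computable.ofNat ℕ+).comp Computable.snd).to₂

theorem partrec_universalFun (k : ℕ+) : Partrec (universalFun k) := by
  have hoff : Computable fun x : ℕ+ => decide (offset x = 0) :=
    (Primrec.eq.comp (primrec_offset.comp primrec_pnat_val) (Primrec.const 0)).decide.to_comp
  have hen : Computable₂ fun (x : ℕ+) (s : ℕ) => decide (EnumeratedBy x s) :=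
    ((primrecRel_enumeratedBy.comp (primrec_pnat_val.comp Primrec.fst)
      Primrec.snd).primrecRel (α := ℕ+) (β := ℕ)).decide.to_comp
  exact Partrec.cond hoff (partrec_runPair.comp (primrec_log_two.comp primrec_pnat_val).to_comp)
    ((Partrec.rfind hen.partrec₂).map (Computable.const k).to₂)

/-- Program `c` on input `x` is simulated at the power of two whose exponent is the pair
`(c, x)`. -/
theorem isUniversal_universalFun (k : ℕ+) : IsUniversal (universalFun k) := by
  refine ⟨partrec_universalFun k, fun g x =>
    Nat.succPNat (2 ^ Nat.pair (Encodable.encode g) (Encodable.encode x) - 1), ?_, ?_⟩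
  · exact Primrec.to_comp ((Primrec.ofNat ℕ+).comp (Primrec.pred.comp (primrec_two_pow.comp
      (Primrec₂.natPair.comp (Primrec.encode.comp Primrec.fst)
        (Primrec.encode.comp Primrec.snd)))))
  · intro F hF
    obtain ⟨c, hc⟩ := Code.exists_code.1 hF
    refine ⟨Denumerable.ofNat ℕ+ (Encodable.encode c), fun x => ?_⟩
    change universalFun k (Nat.succPNat (2 ^ Nat.pair (Encodable.encode
      (Denumerable.ofNat ℕ+ (Encodable.encode c))) (Encodable.encode x) - 1)) = F x
    rw [Denumerable.encode_ofNat]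
    set m := Nat.pair (Encodable.encode c) (Encodable.encode x) with hm
    have hval : ((Nat.succPNat (2 ^ m - 1) : ℕ+) : ℕ) = 2 ^ m + 0 := by
      have : 0 < 2 ^ m := by positivity
      rw [Nat.succPNat_coe]; omega
    have h0 : offset (2 ^ m + 0) = 0 := offset_two_pow_add (by positivity)
    have hl : Nat.log 2 (2 ^ m + 0) = m := log_two_pow_add (by positivity)
    rw [universalFun, hval, decide_eq_true h0, cond_true, hl, runPair, hm, Nat.unpair_pair]
    simp only [Denumerable.ofNat_encode, hc, Encodable.encodek, Part.coe_some, Part.bind_some]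
    rw [Part.map_map]
    convert Part.map_id' (fun y => ?_) (F x)
    exact Denumerable.ofNat_encode y

theorem mem_universalFun_of_enumeratedBy {k x : ℕ+} (hx : offset x ≠ 0)
    (h : ∃ s, EnumeratedBy x s) : k ∈ universalFun k x := by
  obtain ⟨s, hs⟩ := h
  obtain ⟨t, ht, -⟩ := Nat.rfind_min' (p := fun s => decide (EnumeratedBy x s)) (decide_eq_true hs)
  rw [universalFun, decide_eq_false hx, cond_false]
  exact Part.mem_map _ ht

theorem mem_haltingSet_iff {k x : ℕ+} (hx : offset x ≠ 0) :
    x ∈ haltingSet (universalFun k) ↔ ∃ s, EnumeratedBy x s := by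
  refine ⟨fun h => ?_, fun h => Part.dom_iff_mem.2 ⟨k, mem_universalFun_of_enumeratedBy hx h⟩⟩
  obtain ⟨v, hv⟩ := Part.dom_iff_mem.1 h
  rw [universalFun, decide_eq_false hx, cond_false] at hv
  obtain ⟨s, hs, -⟩ := (Part.mem_map_iff _).1 hv
  exact ⟨s, of_decide_eq_true (Part.mem_some_iff.1 (Nat.rfind_spec hs)).symm⟩

/-! ### Decidable subsets miss infinitely many gaps -/

/-- A decidable set has an index: a number whose code outputs `0`, among positive integers, exactly
off the set. -/
theorem IsDecidable.exists_index {D : Set ℕ+} (hD : IsDecidable D) :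
    ∃ e : ℕ, ∀ x : ℕ+, 0 ∈ Code.eval (Denumerable.ofNat Code e) x ↔ x ∉ D := by
  obtain ⟨_, hD⟩ := hD
  have hg : Computable fun n : ℕ => Encodable.encode (decide (Denumerable.ofNat ℕ+ (n - 1) ∈ D)) :=
    Computable.encode.comp (hD.comp ((Computable.ofNat ℕ+).comp Computable.pred))
  obtain ⟨c, hc⟩ := Code.exists_code.1 (Partrec.nat_iff.1 hg.partrec)
  refine ⟨Encodable.encode c, fun x => ?_⟩
  have hx : Denumerable.ofNat ℕ+ ((x : ℕ) - 1) = x := Denumerable.ofNat_encode x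
  rw [Denumerable.ofNat_encode, hc, PFun.coe_val, Part.mem_some_iff, hx]
  by_cases h : x ∈ D <;> simp [h]

/-- Every gap withheld by the index of a decidable subset of the halting set is eventually cleared:
otherwise it lies outside the halting set, hence outside the subset, and the program deciding the
subset clears it. -/
theorem exists_clearedBy {D : Set ℕ+} {k : ℕ+} {e n : ℕ}
    (he : ∀ x : ℕ+, 0 ∈ Code.eval (Denumerable.ofNat Code e) x ↔ x ∉ D)
    (hsub : D ⊆ haltingSet (universalFun k)) (hn : activeBlock e n = n) :
    ∃ s, ClearedBy n e s := by
  by_contra! hc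
  have hev : ∀ x : ℕ, ∃ s, Nat.log 2 x = n ∧ offset x ≠ 0 ∧ gapIndex x = e →
      Code.evaln s (Denumerable.ofNat Code e) x = some 0 := by
    intro x
    by_cases hx : Nat.log 2 x = n ∧ offset x ≠ 0 ∧ gapIndex x = e
    · have hpos : 0 < x := by
        rcases Nat.eq_zero_or_pos x with rfl | h
        · exact absurd (by simp [offset]) hx.2.1
        · exact h
      have hxD : (⟨x, hpos⟩ : ℕ+) ∉ D := by
        intro hxD
        obtain ⟨s, hs⟩ := (mem_haltingSet_iff (x := ⟨x, hpos⟩) hx.2.1).1 (hsub hxD)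
        rw [PNat.mk_coe, EnumeratedBy, hx.1, hx.2.2] at hs
        exact hs.elim (fun h => h hn) (hc s)
      obtain ⟨s, hs⟩ := Code.evaln_complete.1 ((he ⟨x, hpos⟩).2 hxD)
      exact ⟨s, fun _ => hs⟩
    · exact ⟨0, fun h => absurd h hx⟩
  choose s hs using hev
  exact hc ((Finset.range (2 ^ (n + 1))).sup s) fun x hx hxe =>
    Code.evaln_mono (Finset.le_sup (Finset.mem_range.2 hx)) (hs x hxe)

/-- For some index `e`, a decidable subset of the halting set misses the `e`-th gaps of infinitely
many blocks. -/
theorem exists_gap_disjoint {D : Set ℕ+} {k : ℕ+} (hD : IsDecidable D)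
    (hsub : D ⊆ haltingSet (universalFun k)) :
    ∃ e : ℕ, ∀ N, ∃ n, N ≤ n ∧ ∀ x : ℕ+, Nat.log 2 x = n → offset x ≠ 0 → gapIndex x = e →
      x ∉ D := by
  obtain ⟨e, he⟩ := hD.exists_index
  refine ⟨e, fun N => ?_⟩
  obtain ⟨n, hN, hn⟩ := exists_activeBlock_eq (fun n => exists_clearedBy he hsub) N
  obtain ⟨s, hs⟩ := exists_clearedBy he hsub hn
  refine ⟨n, hN, fun x h₁ h₂ h₃ => (he x).1 (Code.evaln_sound (hs x ?_ ⟨h₁, h₂, h₃⟩))⟩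
  exact h₁ ▸ lt_two_pow_log_succ x

/-! ### Densities -/

/-- A set that misses arbitrarily late intervals `(a, b]` of fixed relative length has no positive
density. -/
theorem HasDensity.nonpos_of_gaps {D : Set ℕ+} {r δ : ℝ} (h : HasDensity D r) (hδ : 0 < δ)
    (hgap : ∀ N : ℕ+, ∃ a b : ℕ+, N ≤ a ∧ (1 + δ) * a ≤ b ∧ ∀ x ∈ D, a < x → ¬ x ≤ b) :
    r ≤ 0 := by
  by_contra! hr
  -- This choice makes `(1 + δ) * (r - ε) = r + ε`.
  set ε := r * δ / (2 + δ) with hε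
  have hε0 : 0 < ε := by positivity
  have hεr : ε * (2 + δ) = r * δ := by rw [hε]; field_simp
  have hlt : ε < r := by nlinarith
  obtain ⟨N, hN⟩ := (Metric.tendsto_atTop.1 h) ε hε0
  obtain ⟨a, b, ha, hab, hD⟩ := hgap N
  have ha0 : (0 : ℝ) < a := by exact_mod_cast a.pos
  have hle : a ≤ b := by
    have : (a : ℝ) ≤ b := by nlinarith
    exact_mod_cast this
  have heq : Set.Icc 1 b ∩ D = Set.Icc 1 a ∩ D := by
    ext x
    refine ⟨fun ⟨⟨h1, hb⟩, hx⟩ => ⟨⟨h1, ?_⟩, hx⟩, fun ⟨⟨h1, hx⟩, hxD⟩ => ⟨⟨h1, hx.trans hle⟩, hxD⟩⟩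
    by_contra! hax
    exact hD x hx hax hb
  have h1 := hN a ha
  have h2 := hN b (ha.trans hle)
  rw [heq] at h2
  have hb0 : (0 : ℝ) < b := by exact_mod_cast b.pos
  rw [Real.dist_eq, abs_lt] at h1 h2
  have h3 := (div_lt_iff₀ ha0).1 (sub_lt_iff_lt_add.1 h1.2)
  have h4 := (lt_div_iff₀ hb0).1 (lt_sub_iff_add_lt.1 h2.1)
  nlinarith [mul_le_mul_of_nonneg_left hab (sub_pos.2 hlt).le]

theorem ncard_inter_add_ncard_inter_compl (A : Set ℕ+) (N : ℕ+) :
    (Set.Icc 1 N ∩ A).ncard + (Set.Icc 1 N ∩ Aᶜ).ncard = (N : ℕ) := by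
  rw [← Set.sdiff_eq, Set.ncard_inter_add_ncard_sdiff_eq_ncard _ _ (Set.finite_Icc 1 N),
    ← Finset.coe_Icc, Set.ncard_coe_finset, PNat.card_Icc]
  simp

/-- If the complement of a set meets `[1, N]` in at most `C + c * N / K` points, where `K` is
arbitrarily large and `C` may depend on it, then the set is generic. -/
theorem isGeneric_of_ncard_compl_le {A : Set ℕ+} {c : ℝ}
    (h : ∀ K : ℕ, 0 < K → ∃ C : ℝ, ∀ N : ℕ+, ((Set.Icc 1 N ∩ Aᶜ).ncard : ℝ) ≤ C + c * (N / K)) :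
    IsGeneric A := by
  refine Metric.tendsto_atTop.2 fun ε hε => ?_
  obtain ⟨K, hK⟩ := exists_nat_gt (2 * |c| / ε)
  have hK0 : (0 : ℝ) < K := lt_of_le_of_lt (by positivity) hK
  obtain ⟨C, hC⟩ := h K (by exact_mod_cast hK0)
  obtain ⟨M, hM⟩ := exists_nat_gt (2 * |C| / ε)
  refine ⟨Nat.succPNat M, fun N hN => ?_⟩
  have hN0 : (0 : ℝ) < N := by exact_mod_cast N.pos
  have hMN : (M : ℝ) ≤ N := by
    have : (M + 1 : ℕ) ≤ (N : ℕ) := hN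
    exact_mod_cast (by omega : M ≤ (N : ℕ))
  have hsum : ((Set.Icc 1 N ∩ A).ncard : ℝ) + (Set.Icc 1 N ∩ Aᶜ).ncard = (N : ℝ) := by
    exact_mod_cast ncard_inter_add_ncard_inter_compl A N
  have hCε : 2 * C < ε * N := by
    rw [div_lt_iff₀ hε] at hM
    nlinarith [le_abs_self C]
  have hcε : 2 * (c * (N / K)) < ε * N := by
    rw [div_lt_iff₀ hε] at hK
    have : c * (N / K) = c / K * N := by ring
    rw [this, ← mul_assoc]
    refine mul_lt_mul_of_pos_right ?_ hN0
    rw [← mul_div_assoc, div_lt_iff₀ hK0]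
    nlinarith [le_abs_self c]
  have heq : ((Set.Icc 1 N ∩ A).ncard : ℝ) / N - 1 = -((Set.Icc 1 N ∩ Aᶜ).ncard / N) := by
    rw [eq_sub_of_add_eq hsum]
    field_simp
    ring
  rw [Real.dist_eq, heq, abs_neg, abs_of_nonneg (by positivity), div_lt_iff₀ hN0]
  linarith [hC N]

theorem HasDensity.inter_isGeneric {R S : Set ℕ+} {r : ℝ} (hR : HasDensity R r)
    (hS : IsGeneric S) : HasDensity (R ∩ S) r := by
  -- At most `N - #([1, N] ∩ S)` elements of `R` below `N` are lost.
  have hlow : Tendsto (fun N : ℕ+ => ((Set.Icc 1 N ∩ R).ncard : ℝ) / N +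
      ((Set.Icc 1 N ∩ S).ncard : ℝ) / N - 1) atTop (𝓝 r) := by
    simpa using (Filter.Tendsto.add hR hS).sub_const 1
  refine tendsto_of_tendsto_of_tendsto_of_le_of_le hlow hR (fun N => ?_) fun N => ?_
  · have hN0 : (0 : ℝ) < N := by exact_mod_cast N.pos
    have hle : (Set.Icc 1 N ∩ R).ncard ≤
        (Set.Icc 1 N ∩ (R ∩ S)).ncard + (Set.Icc 1 N ∩ Sᶜ).ncard := by
      refine (Set.ncard_le_ncard ?_ ((Set.finite_Icc 1 N).subset ?_)).trans (Set.ncard_union_le _ _)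
      · intro x ⟨hx, hxR⟩
        by_cases hxS : x ∈ S
        · exact Or.inl ⟨hx, hxR, hxS⟩
        · exact Or.inr ⟨hx, hxS⟩
      · exact Set.union_subset Set.inter_subset_left Set.inter_subset_left
    have hsum := ncard_inter_add_ncard_inter_compl S N
    have hle' : ((Set.Icc 1 N ∩ R).ncard : ℝ) + (Set.Icc 1 N ∩ S).ncard ≤
        (Set.Icc 1 N ∩ (R ∩ S)).ncard + N := by exact_mod_cast (by omega)
    change _ / _ + _ / _ - 1 ≤ _ / _
    rw [← add_div, div_sub_one hN0.ne']
    gcongr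
    linarith
  · change _ / _ ≤ _ / _
    gcongr
    · exact (Set.finite_Icc 1 N).subset Set.inter_subset_left
    · exact Set.inter_subset_left

/-- No decidable subset of the halting set has positive density. -/
theorem HasDensity.nonpos_of_subset_haltingSet {D : Set ℕ+} {k : ℕ+} {r : ℝ}
    (h : HasDensity D r) (hD : IsDecidable D) (hsub : D ⊆ haltingSet (universalFun k)) :
    r ≤ 0 := by
  obtain ⟨e, he⟩ := exists_gap_disjoint hD hsub
  refine h.nonpos_of_gaps (δ := 1 / (4 * ((e + 2) * (e + 3)))) (by positivity) fun N => ?_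
  obtain ⟨n, hn, hgap⟩ := he ((N : ℕ) + 2 * ((e + 2) * (e + 3)))
  have hpow : (N : ℕ) + 2 * ((e + 2) * (e + 3)) ≤ 2 ^ n := hn.trans Nat.lt_two_pow_self.le
  have hpos : 0 < 2 ^ n := by positivity
  -- The interval `(a, b]` lies in the `e`-th gap of block `n`. Despite rounding, its proportion of the
  -- block is at least half of `1 / ((e + 2) * (e + 3))`; another factor `2` is lost because the
  -- length is compared with `a`, which may be as large as `2 ^ (n + 1)`.
  obtain ⟨a, ha⟩ : ∃ a : ℕ+, (a : ℕ) = 2 ^ n + 2 ^ n / (e + 3) := ⟨⟨_, by positivity⟩, rfl⟩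
  obtain ⟨b, hb⟩ : ∃ b : ℕ+, (b : ℕ) = 2 ^ n + 2 ^ n / (e + 2) := ⟨⟨_, by positivity⟩, rfl⟩
  refine ⟨a, b, ?_, ?_, fun x hxD hax hxb => ?_⟩
  · rw [← PNat.coe_le_coe, ha]
    generalize 2 ^ n / (e + 3) = z
    omega
  · rw [ha, hb]
    have hP : (2 * ((e + 2) * (e + 3)) : ℝ) ≤ (2 ^ n : ℕ) := by exact_mod_cast (by omega)
    have hA : ((2 ^ n / (e + 3) : ℕ) : ℝ) ≤ (2 ^ n : ℕ) / (e + 3) := by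
      exact_mod_cast Nat.cast_div_le (α := ℝ) (m := 2 ^ n) (n := e + 3)
    have hB : ((2 ^ n : ℕ) : ℝ) / (e + 2) ≤ ((2 ^ n / (e + 2) : ℕ) : ℝ) + 1 := by
      rw [div_le_iff₀ (by positivity)]
      exact_mod_cast (Nat.lt_mul_of_div_lt (Nat.lt_succ_self _) (by omega)).le
    rw [Nat.cast_add, Nat.cast_add]
    generalize ((2 ^ n / (e + 3) : ℕ) : ℝ) = A at *
    generalize ((2 ^ n / (e + 2) : ℕ) : ℝ) = B at *
    generalize ((2 ^ n : ℕ) : ℝ) = P at *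
    have hAP : A ≤ P := hA.trans (div_le_self (by nlinarith) (by linarith))
    have hdiff : P / (e + 2) - P / (e + 3) = P / ((e + 2) * (e + 3)) := by field_simp; ring
    have hone : 1 ≤ P / (2 * ((e + 2) * (e + 3))) := (one_le_div₀ (by positivity)).2 hP
    have hsplit : P / ((e + 2) * (e + 3)) = 2 * (P / (2 * ((e + 2) * (e + 3)))) := by field_simp
    have hδ : 1 / (4 * ((e + 2) * (e + 3))) * (P + A) ≤ P / (2 * ((e + 2) * (e + 3)) : ℝ) := by
      have : P / (2 * ((e + 2) * (e + 3)) : ℝ) = 1 / (4 * ((e + 2) * (e + 3))) * (P + P) := by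
        field_simp; ring
      rw [this]
      gcongr
    linarith
  · rw [← PNat.coe_lt_coe, ha] at hax
    rw [← PNat.coe_le_coe, hb] at hxb
    obtain ⟨y, hy⟩ := Nat.exists_eq_add_of_le ((Nat.le_add_right _ _).trans hax.le)
    have hlow : 2 ^ n / (e + 3) < y := Nat.lt_of_add_lt_add_left (hy ▸ hax)
    have hupp : y ≤ 2 ^ n / (e + 2) := Nat.le_of_add_le_add_left (hy ▸ hxb)
    have hy0 : 0 < y := Nat.zero_lt_of_lt hlow
    have hylt : y < 2 ^ n := hupp.trans_lt (Nat.div_lt_self hpos (by omega))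
    have hdiv : 2 ^ n / y = e + 2 := by
      rw [Nat.le_div_iff_mul_le (by positivity)] at hupp
      rw [Nat.div_lt_iff_lt_mul (by positivity)] at hlow
      refine Nat.div_eq_of_lt_le (by linarith) ?_
      calc 2 ^ n < y * (e + 3) := hlow
        _ = _ := by ring
    refine hgap x ?_ ?_ ?_ hxD <;> rw [hy]
    · exact log_two_pow_add hylt
    · rw [offset_two_pow_add hylt]; exact hy0.ne'
    · rw [gapIndex_two_pow_add hylt, hdiv, Nat.add_sub_cancel]

/-! ### Genericity of the halting set -/

theorem card_filter_mul_offset_le_two_pow {K : ℕ} (hK : 0 < K) (n : ℕ) :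
    ((((Finset.range (2 ^ n)).filter fun x => K * offset x ≤ 2 ^ Nat.log 2 x).card : ℕ) : ℝ) ≤
      2 * K + 2 * (2 ^ n / K) := by
  have hK' : (0 : ℝ) < K := by exact_mod_cast hK
  induction n with
  | zero =>
    have h1 : (1 : ℝ) ≤ K := by exact_mod_cast hK
    have h2 : (0 : ℝ) ≤ 2 * (2 ^ 0 / K) := by positivity
    refine (Nat.cast_le.2 (Finset.card_filter_le _ _)).trans ?_
    rw [Finset.card_range, pow_zero, Nat.cast_one]
    linarith
  | succ n ih =>
    rcases lt_or_ge (2 ^ n) K with hn | hn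
    · have h1 : (((Finset.range (2 ^ (n + 1))).filter
          fun x => K * offset x ≤ 2 ^ Nat.log 2 x).card : ℝ) ≤ (2 * K : ℕ) := by
        refine Nat.cast_le.2 ((Finset.card_filter_le _ _).trans ?_)
        rw [Finset.card_range, pow_succ]
        omega
      have : (0 : ℝ) ≤ 2 * (2 ^ (n + 1) / K) := by positivity
      push_cast at h1
      linarith
    -- The new block contributes at most `2 ^ n / K + 1 ≤ 2 * (2 ^ n / K)` points.
    · have hsub : ((Finset.range (2 ^ (n + 1))).filter fun x => K * offset x ≤ 2 ^ Nat.log 2 x) ⊆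
          ((Finset.range (2 ^ n)).filter fun x => K * offset x ≤ 2 ^ Nat.log 2 x) ∪
          (Finset.range (2 ^ n / K + 1)).image fun y => 2 ^ n + y := by
        intro x hx
        rw [Finset.mem_filter, Finset.mem_range] at hx
        rw [Finset.mem_union, Finset.mem_filter, Finset.mem_range, Finset.mem_image]
        rcases lt_or_ge x (2 ^ n) with h | h
        · exact Or.inl ⟨h, hx.2⟩
        · obtain ⟨y, rfl⟩ := Nat.exists_eq_add_of_le h
          have hy : y < 2 ^ n := by
            have := hx.1
            rw [pow_succ] at this
            omega
          refine Or.inr ⟨y, Finset.mem_range.2 (Nat.lt_succ_of_le ?_), rfl⟩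
          have := hx.2
          rw [offset_two_pow_add hy, log_two_pow_add hy] at this
          rw [Nat.le_div_iff_mul_le hK]
          linarith
      have hcard := (Finset.card_le_card hsub).trans (Finset.card_union_le _ _)
      have himg := (Finset.card_image_le (s := Finset.range (2 ^ n / K + 1))
        (f := fun y => 2 ^ n + y))
      rw [Finset.card_range] at himg
      have hdiv : ((2 ^ n / K : ℕ) : ℝ) ≤ 2 ^ n / K := by
        exact_mod_cast Nat.cast_div_le (α := ℝ) (m := 2 ^ n) (n := K)
      have hone : (1 : ℝ) ≤ 2 ^ n / K := by
        rw [one_le_div₀ hK']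
        exact_mod_cast hn
      have hcard' : (((Finset.range (2 ^ (n + 1))).filter
          fun x => K * offset x ≤ 2 ^ Nat.log 2 x).card : ℝ) ≤
          ((Finset.range (2 ^ n)).filter fun x => K * offset x ≤ 2 ^ Nat.log 2 x).card +
            ((2 ^ n / K : ℕ) + 1) := by exact_mod_cast hcard.trans (by gcongr)
      have hpow : (2 : ℝ) ^ (n + 1) / K = 2 * (2 ^ n / K) := by ring
      rw [hpow]
      linarith

/-- The points close to the beginning of their block, relative to its length, have small upper
density. -/
theorem card_filter_mul_offset_le {K : ℕ} (hK : 0 < K) (N : ℕ+) :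
    ((((Finset.range (N + 1)).filter fun x => K * offset x ≤ 2 ^ Nat.log 2 x).card : ℕ) : ℝ) ≤
      2 * K + 4 * (N / K) := by
  have hlt : (N : ℕ) < 2 ^ (Nat.log 2 N + 1) := lt_two_pow_log_succ N
  have hle : (2 : ℝ) ^ (Nat.log 2 N + 1) ≤ 2 * N := by
    rw [pow_succ, mul_comm]
    have : 2 ^ Nat.log 2 N ≤ (N : ℕ) := Nat.pow_log_le_self 2 N.ne_zero
    gcongr
    exact_mod_cast this
  calc _ ≤ ((((Finset.range (2 ^ (Nat.log 2 N + 1))).filter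
          fun x => K * offset x ≤ 2 ^ Nat.log 2 x).card : ℕ) : ℝ) := by
        gcongr
        omega
    _ ≤ 2 * K + 2 * (2 ^ (Nat.log 2 N + 1) / K) := card_filter_mul_offset_le_two_pow hK _
    _ ≤ 2 * K + 2 * (2 * N / K) := by gcongr
    _ = _ := by ring

/-- For each index `e`, at most one gap is permanently withheld. -/
theorem exists_bound_of_not_enumerated (e : ℕ) :
    ∃ b, ∀ x, gapIndex x = e → (∀ s, ¬ EnumeratedBy x s) → x < b := by
  by_cases h : ∃ n, activeBlock e n = n ∧ ∀ s, ¬ ClearedBy n e s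
  · obtain ⟨n, hn, hc⟩ := h
    refine ⟨2 ^ (n + 1), fun x hx hs => ?_⟩
    have hact : activeBlock e (Nat.log 2 x) = Nat.log 2 x := by
      by_contra hne
      exact hs 0 (Or.inl (hx ▸ hne))
    by_contra! hlt
    have hlog := Nat.le_log_of_pow_le one_lt_two hlt
    have := activeBlock_eq_of_not_cleared hn hc (Nat.le_of_succ_le hlog)
    omega
  · push Not at h
    refine ⟨0, fun x hx hs => ?_⟩
    have hact : activeBlock e (Nat.log 2 x) = Nat.log 2 x := by
      by_contra hne
      exact hs 0 (Or.inl (hx ▸ hne))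
    obtain ⟨s, hc⟩ := h _ hact
    exact absurd (Or.inr (hx ▸ hc)) (hs s)

/-- Non-halting points of gap index below `K` are bounded; the other non-halting points are within
`2 ^ n / K` of the beginning `2 ^ n` of their block. -/
theorem isGeneric_haltingSet (k : ℕ+) : IsGeneric (haltingSet (universalFun k)) := by
  refine isGeneric_of_ncard_compl_le (c := 4) fun K hK => ?_
  choose b hb using exists_bound_of_not_enumerated
  set B := (Finset.range K).sup b
  refine ⟨B + 2 * K, fun N => ?_⟩
  have hsub : (fun x : ℕ+ => (x : ℕ)) '' (Set.Icc 1 N ∩ (haltingSet (universalFun k))ᶜ) ⊆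
      ((Finset.range B ∪
        (Finset.range (N + 1)).filter fun x => K * offset x ≤ 2 ^ Nat.log 2 x : Finset ℕ) :
          Set ℕ) := by
    rintro _ ⟨x, ⟨⟨-, hxN⟩, hx⟩, rfl⟩
    rw [Finset.mem_coe, Finset.mem_union, Finset.mem_range, Finset.mem_filter, Finset.mem_range]
    have hxN' : (x : ℕ) < N + 1 := Nat.lt_succ_of_le hxN
    rcases eq_or_ne (offset x) 0 with h0 | h0
    · exact Or.inr ⟨hxN', by simp [h0]⟩
    rw [Set.mem_compl_iff, mem_haltingSet_iff h0, not_exists] at hx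
    rcases lt_or_ge (gapIndex x) K with hg | hg
    · exact Or.inl ((hb _ x rfl hx).trans_le (Finset.le_sup (Finset.mem_range.2 hg)))
    · refine Or.inr ⟨hxN', (Nat.le_div_iff_mul_le (Nat.pos_of_ne_zero h0)).1 ?_⟩
      exact hg.trans (Nat.sub_le _ _)
  have hcard := (Set.ncard_le_ncard hsub (Finset.finite_toSet _))
  rw [Set.ncard_image_of_injective _ PNat.coe_injective, Set.ncard_coe_finset] at hcard
  have h2 := hcard.trans (Finset.card_union_le _ _)
  rw [Finset.card_range] at h2
  have h3 : ((Set.Icc 1 N ∩ (haltingSet (universalFun k))ᶜ).ncard : ℝ) ≤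
      B + ((((Finset.range (N + 1)).filter
        fun x => K * offset x ≤ 2 ^ Nat.log 2 x).card : ℕ) : ℝ) := by exact_mod_cast h2
  linarith [card_filter_mul_offset_le hK N]

theorem not_isWeaklyDecidable_haltingSet (k : ℕ+) :
    ¬ IsWeaklyDecidable (haltingSet (universalFun k)) := by
  rintro ⟨r, hr, -, R, -, hR, hD⟩
  exact hr.not_ge ((hR.inter_isGeneric (isGeneric_haltingSet k)).nonpos_of_subset_haltingSet hD
    Set.inter_subset_right)

/-- The point `3 = 2 + 1` forms the gap of index `0` in block `1`, and code `0` is the zero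
function, which clears it. -/
theorem exists_enumeratedBy_three : ∃ s, EnumeratedBy 3 s := by
  have hlog : Nat.log 2 3 = 1 := log_two_pow_add (n := 1) (y := 1) (by norm_num)
  have hgap : gapIndex 3 = 0 := gapIndex_two_pow_add (n := 1) (y := 1) (by norm_num)
  refine ⟨4, Or.inr ?_⟩
  rw [hlog, hgap]
  intro x hx _
  have hx' : x ≤ 3 := by norm_num at hx; omega
  rw [Code.ofNatCode_eq, Code.ofNatCode]
  simp [Code.evaln, hx']

/-- The functions differ at `3`, where `universalFun k` takes the value `k`. -/
theorem universalFun_injective : Function.Injective universalFun := by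
  intro k l h
  have hoff : offset ((3 : ℕ+) : ℕ) ≠ 0 := by
    have : offset 3 = 1 := offset_two_pow_add (n := 1) (y := 1) (by norm_num)
    rw [PNat.val_ofNat, this]
    exact one_ne_zero
  have hk := mem_universalFun_of_enumeratedBy (k := k) hoff exists_enumeratedBy_three
  rw [h] at hk
  exact Part.mem_unique hk (mem_universalFun_of_enumeratedBy (k := l) hoff exists_enumeratedBy_three)

end HaltingDensity

theorem mainTheorem4 :
    Set.Infinite {U : ℕ+ →. ℕ+ | HaltingDensity.IsUniversal U ∧
      HaltingDensity.IsGeneric (HaltingDensity.haltingSet U) ∧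
      ¬ HaltingDensity.IsWeaklyDecidable (HaltingDensity.haltingSet U)} :=
  Set.infinite_of_injective_forall_mem HaltingDensity.universalFun_injective fun k =>
    ⟨HaltingDensity.isUniversal_universalFun k, HaltingDensity.isGeneric_haltingSet k,
      HaltingDensity.not_isWeaklyDecidable_haltingSet k⟩
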